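/- Let $n\ge 2$ and let $\Delta^n$ be the set of probability distributions $x=(x_1,\dots,x_n)$ on $\{1,\dots,n\}$. The Bayesian order on $\Delta^n$ is defined by: $x\sqsubseteq y$ iff there is a permutation $\sigma$ of $\{1,\dots,n\}$ such that $x\cdot\sigma=(x_{\sigma(1)},\dots,x_{\sigma(n)})$ and $y\cdot\sigma$ are both decreasing and $(x\cdot\sigma)_i\,(y\cdot\sigma)_{i+1}\le (x\cdot\sigma)_{i+1}\,(y\cdot\sigma)_i$ for all $1\le i\le n-1$. Let $\mathrm{Max}(\Delta^n)$ be the set of maximal elements (those $e$ such that $e\sqsubseteq y$ only for $y=e$), and let $\mu(x)=-\sum_{i=1}^n x_i\log x_i$ be Shannon entropy (with $0\log 0=0$). Let $\mathrm{Coord}(\Delta^n)$ be the set of $x\in\Delta^n$ with at most two distinct values, and for $x\in\Delta^n$ let $I_1^x$ be the set of indices at which $x$ takes its largest value. For every $x\in\mathrm{Coord}(\Delta^n)$ having $0$ among its values, the coordinate axis of $x$ is the set of all $y\in\mathrm{Coord}(\Delta^n)$ with $I_1^y=I_1^x$. Then: (1) The identity is the only order-isomorphism $h$ of $(\Delta^n,\sqsubseteq)$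 onto itself such that $h(e)=e$ for all $e\in\mathrm{Max}(\Delta^n)$ and $\mu(h(x))=\mu(x)$ for all $x\in\Delta^n$. (2) The same holds with $\mu$ replaced by any map $f$ from $\Delta^n$ to a preordered set that, on each coordinate axis, is strictly increasing or strictly decreasing with respect to $\sqsubseteq$: the identity is the only order-isomorphism $h$ of $(\Delta^n,\sqsubseteq)$ onto itself such that $h(e)=e$ for all $e\in\mathrm{Max}(\Delta^n)$ and $f(h(x))=f(x)$ for all $x\in\Delta^n$. (3) Shannon entropy $\mu$ is such a map: it is strictly decreasing with respect to $\sqsubseteq$ on each coordinate axis. -/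

import Mathlib

namespace BayesianOrder

/-- The simplex of all probability distributions on an `n`-element set. -/
abbrev Simplex (n : ℕ) : Type := stdSimplex ℝ (Fin n)

/-- The Bayesian order: some permutation `σ` puts both `x` and `y` in decreasing order, and
consecutive entries of the two sorted lists satisfy
`(x ∘ σ)ᵢ (y ∘ σ)ᵢ₊₁ ≤ (x ∘ σ)ᵢ₊₁ (y ∘ σ)ᵢ`. -/
def BayesLE {n : ℕ} (x y : Simplex n) : Prop :=
  ∃ σ : Equiv.Perm (Fin n),
    Antitone (x.1 ∘ σ) ∧ Antitone (y.1 ∘ σ) ∧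
    ∀ (i : ℕ) (hi : i + 1 < n),
      x.1 (σ ⟨i, Nat.lt_of_succ_lt hi⟩) * y.1 (σ ⟨i + 1, hi⟩)
        ≤ x.1 (σ ⟨i + 1, hi⟩) * y.1 (σ ⟨i, Nat.lt_of_succ_lt hi⟩)

/-- The maximal elements (pure states): those `e` whose only upper bound is `e` itself. -/
def maxElements (n : ℕ) : Set (Simplex n) :=
  {e | {y | BayesLE e y} = {e}}

/-- Shannon entropy, with `0 log 0 = 0` (in Lean, `Real.log 0 = 0`). -/
noncomputable def entropy {n : ℕ} (x : Simplex n) : ℝ :=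
  -∑ i, x.1 i * Real.log (x.1 i)

/-- The spectrum of `x`: its set of values. -/
def spec {n : ℕ} (x : Simplex n) : Set ℝ := Set.range x.1

/-- Coordinates: distributions with at most two distinct values. -/
def coord (n : ℕ) : Set (Simplex n) := {x | (spec x).encard ≤ 2}

/-- Degenerated coordinates: coordinates having `0` among their values. -/
def degenerateCoord (n : ℕ) : Set (Simplex n) := {x | x ∈ coord n ∧ (0 : ℝ) ∈ spec x}

/-- The set of indices at which `x` takes its largest value. -/
def topIndices {n : ℕ} (x : Simplex n) : Set (Fin n) := {i | ∀ j, x.1 j ≤ x.1 i}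

/-- The coordinate axis labelled by `x` (used for `x ∈ degenerateCoord n`): all coordinates that
take their largest value at the same indices as `x`. -/
def axis {n : ℕ} (x : Simplex n) : Set (Simplex n) :=
  {y | y ∈ coord n ∧ topIndices y = topIndices x}

/-- `f` is strictly increasing on `s`, with respect to the Bayesian order. -/
def StrictIncOn {n : ℕ} {β : Type*} [Preorder β] (f : Simplex n → β)
    (s : Set (Simplex n)) : Prop :=
  ∀ y ∈ s, ∀ z ∈ s, BayesLE y z → y ≠ z → f y < f z

/-- `f` is strictly decreasing on `s`, with respect to the Bayesian order. -/
def StrictDecOn {n : ℕ} {β : Type*} [Preorder β] (f : Simplex n → β)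
    (s : Set (Simplex n)) : Prop :=
  ∀ y ∈ s, ∀ z ∈ s, BayesLE y z → y ≠ z → f z < f y

end BayesianOrder

namespace BayesianOrder

variable {n : ℕ}

/-! The proof probes a state by two-level states, proportional to `1` on a set `A` and to `t` off
it. For `t < 1` such a state lies below `x` exactly when `x j ≤ t * x i` for all `i ∈ A`, `j ∉ A`
(`twoLevel_le_iff`), and those with `0 < t < 1` below `x` determine its upper bounds
(`le_of_twoLevel_le`). An automorphism `h` fixing pure states preserves `topIndices`, because the
pure states above `x` record them. A two-level state with `0 < t < 1` has a chain as lower set, and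
a state with that property has at most two values. So `h` keeps it on its axis, which is itself a
chain, and strict monotonicity of `f` forces it to be fixed. Every probe below `x` is then below `h
x`, so `x ≤ h x`; the same for `h.symm` and antisymmetry give `h x = x`. For entropy, the Gibbs
inequality gives strict decrease along an axis. -/

lemma coord_nonneg (x : Simplex n) (i : Fin n) : 0 ≤ x.1 i := x.2.1 i

lemma coord_sum (x : Simplex n) : ∑ i, x.1 i = 1 := x.2.2

lemma coord_le_one (x : Simplex n) (i : Fin n) : x.1 i ≤ 1 := by
  rw [← coord_sum x]
  exact Finset.single_le_sum (fun j _ => coord_nonneg x j) (Finset.mem_univ i)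

lemma exists_topIndex (x : Simplex n) : ∃ m, ∀ j, x.1 j ≤ x.1 m := by
  have hne : (Finset.univ : Finset (Fin n)).Nonempty := by
    by_contra h
    have := coord_sum x
    rw [Finset.not_nonempty_iff_eq_empty.1 h] at this
    simp at this
  obtain ⟨m, -, hm⟩ := Finset.exists_max_image Finset.univ x.1 hne
  exact ⟨m, fun j => hm j (Finset.mem_univ j)⟩

lemma topIndex_pos (x : Simplex n) {m : Fin n} (hm : ∀ j, x.1 j ≤ x.1 m) : 0 < x.1 m := by
  by_contra h
  have h0 : ∑ i, x.1 i ≤ 0 := Finset.sum_nonpos fun j _ => (hm j).trans (not_lt.1 h)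
  rw [coord_sum x] at h0
  linarith

/-! ### The order without sorting permutations -/

/-- Two comonotone distributions can be sorted simultaneously. -/
lemma exists_common_sort (x y : Fin n → ℝ) (hxy : ∀ i j, x i < x j → y i ≤ y j) :
    ∃ σ : Equiv.Perm (Fin n), Antitone (x ∘ σ) ∧ Antitone (y ∘ σ) := by
  -- Negation makes the sort decreasing; the lexicographic key breaks ties in `x` by `y`.
  let f : Fin n → ℝ ×ₗ ℝ := fun i => toLex (-x i, -y i)
  have hmono : Monotone (f ∘ Tuple.sort f) := Tuple.monotone_sort f
  refine ⟨Tuple.sort f, fun i j hij => ?_, fun i j hij => ?_⟩ <;>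
  · have h := hmono hij
    simp only [Function.comp_apply, f, Prod.Lex.toLex_le_toLex] at h
    simp only [Function.comp_apply]
    rcases h with h | ⟨h1, h2⟩
    · first
        | exact (neg_lt_neg_iff.1 h).le
        | exact hxy _ _ (neg_lt_neg_iff.1 h)
    · first
        | exact (neg_inj.1 h1).ge
        | exact neg_le_neg_iff.1 h2

/-- The Bayesian order in terms of all pairs of entries, without a sorting permutation. -/
lemma bayesLE_iff (x y : Simplex n) : BayesLE x y ↔
    ∀ i j, (x.1 i < x.1 j → y.1 i ≤ y.1 j) ∧
      (x.1 j ≤ x.1 i → y.1 j ≤ y.1 i → x.1 i * y.1 j ≤ x.1 j * y.1 i) := by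
  constructor
  · rintro ⟨σ, hx, hy, h⟩
    have key : ∀ (k l : ℕ) (hk : k < n) (hl : l < n), k ≤ l →
        x.1 (σ ⟨k, hk⟩) * y.1 (σ ⟨l, hl⟩) ≤ x.1 (σ ⟨l, hl⟩) * y.1 (σ ⟨k, hk⟩) := by
      intro k l hk hl hkl
      induction l, hkl using Nat.le_induction with
      | base => exact le_rfl
      | succ l hkl ih =>
        have ih := ih (by omega)
        have hs := h l hl
        have hant : y.1 (σ ⟨l + 1, hl⟩) ≤ y.1 (σ ⟨l, by omega⟩) :=
          hy (show (⟨l, by omega⟩ : Fin n) ≤ ⟨l + 1, hl⟩ from Nat.le_succ l)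
        have y0 := coord_nonneg y (σ ⟨l + 1, hl⟩)
        -- Chaining the ratios cancels the intermediate entry of `y`; if that entry is zero, so is
        -- the next.
        rcases (coord_nonneg y (σ ⟨l, by omega⟩)).eq_or_lt with h0 | h0
        · have : y.1 (σ ⟨l + 1, hl⟩) = 0 := by linarith
          rw [this, mul_zero]
          exact mul_nonneg (coord_nonneg _ _) (coord_nonneg _ _)
        · have h1 := mul_le_mul_of_nonneg_right ih y0
          have h2 := mul_le_mul_of_nonneg_right hs (coord_nonneg y (σ ⟨k, hk⟩))
          refine le_of_mul_le_mul_right ?_ h0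
          linarith
    intro i j
    obtain ⟨k, rfl⟩ := σ.surjective i
    obtain ⟨l, rfl⟩ := σ.surjective j
    refine ⟨fun hlt => ?_, fun h1 h2 => ?_⟩
    · rcases le_total k l with hkl | hkl
      · exact absurd (hx hkl) (not_le.2 hlt)
      · exact hy hkl
    · rcases le_total k l with hkl | hkl
      · exact key k l k.2 l.2 hkl
      · have e1 : x.1 (σ k) = x.1 (σ l) := le_antisymm (hx hkl) h1
        have e2 : y.1 (σ k) = y.1 (σ l) := le_antisymm (hy hkl) h2
        rw [e1, e2]
  · intro h
    obtain ⟨σ, hx, hy⟩ := exists_common_sort x.1 y.1 fun i j => (h i j).1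
    refine ⟨σ, hx, hy, fun i hi => ?_⟩
    have hle : (⟨i, Nat.lt_of_succ_lt hi⟩ : Fin n) ≤ ⟨i + 1, hi⟩ := Nat.le_succ i
    exact (h _ _).2 (hx hle) (hy hle)

/-- Comonotonicity orients every pair, so the two inequalities make `x` and `y` proportional; both
sum to one. -/
lemma BayesLE.antisymm {x y : Simplex n} (hxy : BayesLE x y) (hyx : BayesLE y x) : x = y := by
  rw [bayesLE_iff] at hxy hyx
  have key : ∀ i j, x.1 i * y.1 j = x.1 j * y.1 i := by
    have aux : ∀ i j, x.1 j ≤ x.1 i → y.1 j ≤ y.1 i → x.1 i * y.1 j = x.1 j * y.1 i := by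
      intro i j h1 h2
      have a := (hxy i j).2 h1 h2
      have b := (hyx i j).2 h2 h1
      linarith
    intro i j
    rcases lt_trichotomy (x.1 i) (x.1 j) with h | h | h
    · exact (aux j i h.le ((hxy i j).1 h)).symm
    · rcases le_total (y.1 i) (y.1 j) with h' | h'
      · exact (aux j i h.le h').symm
      · exact aux i j h.ge h'
    · exact aux i j h.le ((hxy j i).1 h)
  refine Subtype.ext (funext fun i => ?_)
  have h : ∑ j, x.1 i * y.1 j = ∑ j, x.1 j * y.1 i := Finset.sum_congr rfl fun j _ => key i j
  rw [← Finset.mul_sum, ← Finset.sum_mul, coord_sum, coord_sum] at h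
  linarith

/-! ### Pure states -/

/-- The pure state concentrated at `i`. -/
def pure (i : Fin n) : Simplex n := ⟨Pi.single i 1, single_mem_stdSimplex ℝ i⟩

lemma pure_self (i : Fin n) : (pure i).1 i = 1 := by simp [pure]

lemma pure_ne {i j : Fin n} (h : j ≠ i) : (pure i).1 j = 0 := by simp [pure, h]

lemma le_pure_iff (x : Simplex n) (i : Fin n) : BayesLE x (pure i) ↔ i ∈ topIndices x := by
  rw [bayesLE_iff]
  constructor
  · intro h j
    by_contra hlt
    push Not at hlt
    have hji : j ≠ i := by rintro rfl; exact lt_irrefl _ hlt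
    have := (h i j).1 hlt
    rw [pure_self, pure_ne hji] at this
    linarith
  · intro h j k
    rcases eq_or_ne j i with rfl | hj
    · rcases eq_or_ne k j with rfl | hk
      · exact ⟨fun h => absurd h (lt_irrefl _), fun _ _ => le_rfl⟩
      · refine ⟨fun hlt => absurd (h k) (not_le.2 hlt), fun _ _ => ?_⟩
        rw [pure_self, pure_ne hk]
        simpa using coord_nonneg x k
    · rw [pure_ne hj]
      refine ⟨fun _ => coord_nonneg _ _, fun _ h2 => ?_⟩
      have : (pure i).1 k = 0 := le_antisymm h2 (coord_nonneg _ _)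
      rw [this]; simp

lemma pure_mem_maxElements (i : Fin n) : pure i ∈ maxElements n := by
  have hself : BayesLE (pure i) (pure i) := by
    rw [le_pure_iff]
    intro j
    rw [pure_self]
    exact coord_le_one _ _
  refine Set.eq_singleton_iff_unique_mem.2 ⟨hself, fun y hy => ?_⟩
  have hy' := (bayesLE_iff _ _).1 hy
  have hz : ∀ j, j ≠ i → y.1 j = 0 := by
    intro j hj
    have h1 : y.1 j ≤ y.1 i := (hy' j i).1 (by rw [pure_self, pure_ne hj]; exact one_pos)
    have h2 := (hy' i j).2 (by rw [pure_self, pure_ne hj]; exact zero_le_one) h1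
    rw [pure_self, pure_ne hj] at h2
    have := coord_nonneg y j
    linarith
  have hi : y.1 i = 1 := by
    rw [← coord_sum y]
    exact (Finset.sum_eq_single i (fun j _ hj => hz j hj) (by simp)).symm
  refine Subtype.ext (funext fun j => ?_)
  rcases eq_or_ne j i with rfl | hj
  · rw [hi, pure_self]
  · rw [hz j hj, pure_ne hj]

/-! ### Two-level states as probes -/

/-- For nonempty `A` and `t ≥ 0` there is a state proportional to `1` on `A` and `t` off `A`. -/
lemma exists_twoLevel (A : Finset (Fin n)) (hA : A.Nonempty) (t : ℝ) (ht : 0 ≤ t) :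
    ∃ (y : Simplex n) (a : ℝ), 0 < a ∧ ∀ i, y.1 i = if i ∈ A then a else t * a := by
  set w : Fin n → ℝ := fun i => if i ∈ A then 1 else t with hw
  have hw0 : ∀ i, 0 ≤ w i := fun i => by
    simp only [hw]; split_ifs
    · exact zero_le_one
    · exact ht
  obtain ⟨m, hm⟩ := hA
  have hpos : 0 < ∑ i, w i :=
    Finset.sum_pos' (fun i _ => hw0 i) ⟨m, Finset.mem_univ m, by simp [hw, hm]⟩
  refine ⟨⟨fun i => w i * (∑ i, w i)⁻¹, fun i => mul_nonneg (hw0 i) (inv_nonneg.2 hpos.le), ?_⟩,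
    (∑ i, w i)⁻¹, inv_pos.2 hpos, fun i => ?_⟩
  · rw [← Finset.sum_mul, mul_inv_cancel₀ hpos.ne']
  · simp only [hw]; split_ifs <;> simp

lemma twoLevel_le_iff {y : Simplex n} {A : Finset (Fin n)} {a t : ℝ} (ha : 0 < a) (ht : 0 ≤ t)
    (ht1 : t < 1) (hy : ∀ i, y.1 i = if i ∈ A then a else t * a) (x : Simplex n) :
    BayesLE y x ↔ ∀ i ∈ A, ∀ j ∉ A, x.1 j ≤ t * x.1 i := by
  have hta : t * a < a := by nlinarith
  rw [bayesLE_iff]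
  constructor
  · intro h i hi j hj
    have e1 : y.1 i = a := by rw [hy, if_pos hi]
    have e2 : y.1 j = t * a := by rw [hy, if_neg hj]
    have h1 : x.1 j ≤ x.1 i := (h j i).1 (by rw [e1, e2]; exact hta)
    have h2 := (h i j).2 (by rw [e1, e2]; exact hta.le) h1
    rw [e1, e2] at h2
    refine le_of_mul_le_mul_left ?_ ha
    linarith
  · intro h i j
    have hle : ∀ k ∈ A, ∀ l ∉ A, x.1 l ≤ x.1 k := fun k hk l hl =>
      (h k hk l hl).trans (mul_le_of_le_one_left (coord_nonneg x k) ht1.le)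
    rw [hy i, hy j]
    by_cases hi : i ∈ A <;> by_cases hj : j ∈ A <;> simp only [hi, hj, if_true, if_false]
    · exact ⟨fun h => absurd h (lt_irrefl _), fun _ h2 => mul_le_mul_of_nonneg_left h2 ha.le⟩
    · refine ⟨fun h => absurd h (not_lt.2 hta.le), fun _ _ => ?_⟩
      have := mul_le_mul_of_nonneg_left (h i hi j hj) ha.le
      linarith
    · exact ⟨fun _ => hle j hj i hi, fun h => absurd h (not_le.2 hta)⟩
    · exact ⟨fun h => absurd h (lt_irrefl _),
        fun _ h2 => mul_le_mul_of_nonneg_left h2 (mul_nonneg ht ha.le)⟩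

/-- Gap estimates for `x` transfer to `z` if the two-level states below `x` are below `z`. -/
lemma gap_transfer {x z : Simplex n}
    (h : ∀ (A : Finset (Fin n)) (t : ℝ), A.Nonempty → 0 < t → t < 1 →
      (∀ i ∈ A, ∀ j ∉ A, x.1 j ≤ t * x.1 i) → ∀ i ∈ A, ∀ j ∉ A, z.1 j ≤ t * z.1 i)
    {A : Finset (Fin n)} {c d : ℝ} (hc : 0 ≤ c) (hcd : c < d) (hoff : ∀ j ∉ A, x.1 j ≤ c)
    (hon : ∀ i ∈ A, d ≤ x.1 i) {i j : Fin n} (hi : i ∈ A) (hj : j ∉ A) :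
    d * z.1 j ≤ c * z.1 i := by
  have hd : 0 < d := hc.trans_lt hcd
  rcases hc.eq_or_lt with rfl | hc
  -- The ratio `c / d = 0` is not an allowed `t`, so arbitrarily small `t` are used instead.
  · have hz : ∀ t : ℝ, 0 < t → t < 1 → z.1 j ≤ t * z.1 i := fun t ht ht1 =>
      h A t ⟨i, hi⟩ ht ht1
        (fun k _ l hl => (hoff l hl).trans (mul_nonneg ht.le (coord_nonneg x k))) i hi j hj
    have : z.1 j ≤ 0 := by
      by_contra hpos
      push Not at hpos
      have h1 := hz (z.1 j / 2) (by linarith) (by linarith [coord_le_one z j])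
      have h2 := mul_le_mul_of_nonneg_left (coord_le_one z i) (half_pos hpos).le
      linarith
    rw [zero_mul]
    exact mul_nonpos_of_nonneg_of_nonpos hd.le this
  · have h1 := h A (c / d) ⟨i, hi⟩ (div_pos hc hd) ((div_lt_one hd).2 hcd)
      (fun k hk l hl => by
        calc x.1 l ≤ c := hoff l hl
          _ = c / d * d := by field_simp
          _ ≤ c / d * x.1 k := mul_le_mul_of_nonneg_left (hon k hk) (div_pos hc hd).le) i hi j hj
    calc d * z.1 j ≤ d * (c / d * z.1 i) := mul_le_mul_of_nonneg_left h1 hd.le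
      _ = c * z.1 i := by field_simp

/-- Each gap between consecutive levels of `x` is an upper-set cut, and the two-level state at that
cut carries its exact ratio over to `z`. -/
lemma le_of_twoLevel_le {x z : Simplex n}
    (h : ∀ (A : Finset (Fin n)) (t : ℝ), A.Nonempty → 0 < t → t < 1 →
      (∀ i ∈ A, ∀ j ∉ A, x.1 j ≤ t * x.1 i) → ∀ i ∈ A, ∀ j ∉ A, z.1 j ≤ t * z.1 i) :
    BayesLE x z := by
  have hcom : ∀ i j, x.1 i < x.1 j → z.1 i ≤ z.1 j := by
    intro i j hij
    obtain ⟨m, hm, hmax⟩ := Finset.exists_max_image (Finset.univ.filter fun k => x.1 k < x.1 j) x.1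
      ⟨i, by simpa using hij⟩
    simp only [Finset.mem_filter, Finset.mem_univ, true_and] at hm hmax
    have hg := gap_transfer h (A := Finset.univ.filter fun k => x.1 j ≤ x.1 k)
      (coord_nonneg x m) hm (fun k hk => hmax k (by simpa using hk)) (fun k hk => by simpa using hk)
      (i := j) (j := i) (by simp) (by simpa using hij)
    have hd : 0 < x.1 j := (coord_nonneg x m).trans_lt hm
    refine le_of_mul_le_mul_left (hg.trans ?_) hd
    exact mul_le_mul_of_nonneg_right hm.le (coord_nonneg z j)
  obtain ⟨σ, hx, hz⟩ := exists_common_sort x.1 z.1 hcom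
  refine ⟨σ, hx, hz, fun i hi => ?_⟩
  set k : Fin n := ⟨i, Nat.lt_of_succ_lt hi⟩
  set l : Fin n := ⟨i + 1, hi⟩
  have hkl : k ≤ l := Nat.le_succ i
  rcases (hx hkl).eq_or_lt with he | hlt
  · simp only [Function.comp_apply] at he
    rw [he]
    exact mul_le_mul_of_nonneg_left (hz hkl) (coord_nonneg _ _)
  -- `A` holds the indices sorted up to position `k`, so the cut falls between `k` and `l`.
  · refine gap_transfer h (A := (Finset.univ.filter fun p => σ.symm p ≤ k))
      (coord_nonneg x (σ l)) hlt (fun p hp => ?_) (fun p hp => ?_) (by simp) ?_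
    · have hp' : k < σ.symm p := by simpa using hp
      have : l ≤ σ.symm p := Nat.succ_le_of_lt hp'
      simpa using hx this
    · have hp' : σ.symm p ≤ k := by simpa using hp
      simpa using hx hp'
    · simp only [Finset.mem_filter, Finset.mem_univ, true_and, Equiv.symm_apply_apply, not_le]
      exact Nat.lt_succ_self i

/-! ### Chains and lower sets -/

/-- States constant on `A` and constant off `A`, with the larger value on `A`, form a chain. -/
lemma twoValued_total {u v : Simplex n} {A : Finset (Fin n)} {a b c d : ℝ}
    (hu : ∀ i, u.1 i = if i ∈ A then a else b) (hv : ∀ i, v.1 i = if i ∈ A then c else d)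
    (hab : b ≤ a) (hcd : d ≤ c) : BayesLE u v ∨ BayesLE v u := by
  have aux : ∀ {u v : Simplex n} {a b c d : ℝ},
      (∀ i, u.1 i = if i ∈ A then a else b) → (∀ i, v.1 i = if i ∈ A then c else d) →
      b ≤ a → d ≤ c → a * d ≤ b * c → BayesLE u v := by
    intro u v a b c d hu hv hab hcd h
    rw [bayesLE_iff]
    intro i j
    rw [hu i, hu j, hv i, hv j]
    by_cases hi : i ∈ A <;> by_cases hj : j ∈ A <;> simp only [hi, hj, if_true, if_false]
    · exact ⟨fun _ => le_rfl, fun _ _ => le_rfl⟩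
    · exact ⟨fun h => absurd h (not_lt.2 hab), fun _ _ => h⟩
    · refine ⟨fun _ => hcd, fun h1 h2 => ?_⟩
      rw [le_antisymm hab h1, le_antisymm hcd h2]
    · exact ⟨fun _ => le_rfl, fun _ _ => le_rfl⟩
  rcases le_total (a * d) (b * c) with h | h
  · exact Or.inl (aux hu hv hab hcd h)
  · exact Or.inr (aux hv hu hcd hab (by linarith))

lemma eq_of_le_of_eq_pos {u y : Simplex n} (h : BayesLE u y) {i j : Fin n}
    (he : y.1 i = y.1 j) (hpos : 0 < y.1 i) : u.1 i = u.1 j := by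
  rw [bayesLE_iff] at h
  have aux : ∀ i j, y.1 i = y.1 j → 0 < y.1 i → u.1 j ≤ u.1 i → u.1 i ≤ u.1 j := by
    intro i j he hpos hle
    have := (h i j).2 hle he.ge
    rw [← he] at this
    exact le_of_mul_le_mul_right this hpos
  rcases le_total (u.1 i) (u.1 j) with hle | hle
  · exact le_antisymm hle (aux j i he.symm (he ▸ hpos) hle)
  · exact le_antisymm (aux i j he hpos hle) hle

/-- Equal positive entries of `y` force equal entries below it, so everything below has the same two
blocks. With `t = 0` the entries off `A` would be free. -/
lemma twoLevel_lower_total {y : Simplex n} {A : Finset (Fin n)} {a t : ℝ} (ha : 0 < a) (ht : 0 < t)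
    (ht1 : t < 1) (hy : ∀ i, y.1 i = if i ∈ A then a else t * a) (hA : A.Nonempty)
    {q : Fin n} (hq : q ∉ A) {u v : Simplex n} (hu : BayesLE u y) (hv : BayesLE v y) :
    BayesLE u v ∨ BayesLE v u := by
  obtain ⟨p, hp⟩ := hA
  have hta : t * a < a := by nlinarith
  have shape : ∀ {u : Simplex n}, BayesLE u y →
      (∀ i, u.1 i = if i ∈ A then u.1 p else u.1 q) ∧ u.1 q ≤ u.1 p := by
    intro u hu
    refine ⟨fun i => ?_, ?_⟩
    · split_ifs with hi
      · exact eq_of_le_of_eq_pos hu (by rw [hy, hy, if_pos hi, if_pos hp])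
          (by rw [hy, if_pos hi]; exact ha)
      · exact eq_of_le_of_eq_pos hu (by rw [hy, hy, if_neg hi, if_neg hq])
          (by rw [hy, if_neg hi]; exact mul_pos ht ha)
    · by_contra hlt
      have := (((bayesLE_iff _ _).1 hu) p q).1 (not_le.1 hlt)
      rw [hy, hy, if_pos hp, if_neg hq] at this
      linarith
  exact twoValued_total (shape hu).1 (shape hv).1 (shape hu).2 (shape hv).2

/-- A state whose lower set is a chain takes only one value besides its largest. -/
lemma not_three_values_of_lower_total {x : Simplex n}
    (h : ∀ u v, BayesLE u x → BayesLE v x → BayesLE u v ∨ BayesLE v u)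
    {i j m : Fin n} (hij : x.1 i < x.1 j) (hjm : x.1 j < x.1 m) : False := by
  have hj0 : 0 < x.1 j := (coord_nonneg x i).trans_lt hij
  obtain ⟨p, hp, hmin⟩ := Finset.exists_min_image (Finset.univ.filter fun k => x.1 j < x.1 k) x.1
    ⟨m, by simpa using hjm⟩
  obtain ⟨q, hq, hmax⟩ := Finset.exists_max_image (Finset.univ.filter fun k => x.1 k < x.1 j) x.1
    ⟨i, by simpa using hij⟩
  simp only [Finset.mem_filter, Finset.mem_univ, true_and] at hp hmin hq hmax
  have hp0 : 0 < x.1 p := hj0.trans hp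
  set A := Finset.univ.filter fun k => x.1 j < x.1 k with hA
  set B := Finset.univ.filter fun k => x.1 j ≤ x.1 k with hB
  have ht0 : 0 < x.1 j / x.1 p := div_pos hj0 hp0
  have ht1 : x.1 j / x.1 p < 1 := (div_lt_one hp0).2 hp
  have hs0 : 0 ≤ x.1 q / x.1 j := div_nonneg (coord_nonneg x q) hj0.le
  have hs1 : x.1 q / x.1 j < 1 := (div_lt_one hj0).2 hq
  have hmA : m ∈ A := by simpa [hA] using hjm
  have hjA : j ∉ A := by simp [hA]
  have hiA : i ∉ A := by simpa [hA] using hij.le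
  have hjB : j ∈ B := by simp [hB]
  have hmB : m ∈ B := by simpa [hB] using hjm.le
  have hiB : i ∉ B := by simpa [hB] using hij
  -- The cuts just above and just below the middle value give incomparable `u` and `v`: `v` does not
  -- separate `m` from `j`, and `u` does not separate `j` from `i`.
  obtain ⟨u, a, ha, hu⟩ := exists_twoLevel A ⟨m, hmA⟩ _ ht0.le
  obtain ⟨v, b, hb, hv⟩ := exists_twoLevel B ⟨j, hjB⟩ _ hs0
  have hux : BayesLE u x := by
    rw [twoLevel_le_iff ha ht0.le ht1 hu]
    intro k hk l hl
    have hl' : x.1 l ≤ x.1 j := by simpa [hA] using hl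
    calc x.1 l ≤ x.1 j := hl'
      _ = x.1 j / x.1 p * x.1 p := by field_simp
      _ ≤ x.1 j / x.1 p * x.1 k :=
        mul_le_mul_of_nonneg_left (hmin k (by simpa [hA] using hk)) ht0.le
  have hvx : BayesLE v x := by
    rw [twoLevel_le_iff hb hs0 hs1 hv]
    intro k hk l hl
    have hk' : x.1 j ≤ x.1 k := by simpa [hB] using hk
    calc x.1 l ≤ x.1 q := hmax l (by simpa [hB] using hl)
      _ = x.1 q / x.1 j * x.1 j := by field_simp
      _ ≤ x.1 q / x.1 j * x.1 k := mul_le_mul_of_nonneg_left hk' hs0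
  rcases h u v hux hvx with h | h
  · have := (twoLevel_le_iff ha ht0.le ht1 hu v).1 h m hmA j hjA
    rw [hv, hv, if_pos hjB, if_pos hmB] at this
    nlinarith
  · have := (twoLevel_le_iff hb hs0 hs1 hv u).1 h j hjB i hiB
    rw [hu, hu, if_neg hjA, if_neg hiA] at this
    nlinarith [mul_pos ht0 ha]

/-! ### Rigidity of automorphisms -/

lemma mem_coord_of_twoValued {x : Simplex n} {A : Finset (Fin n)} {a b : ℝ}
    (hx : ∀ i, x.1 i = if i ∈ A then a else b) : x ∈ coord n := by
  have hsub : spec x ⊆ {a, b} := by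
    rintro _ ⟨i, rfl⟩
    rw [hx i]
    split_ifs <;> simp
  refine (Set.encard_le_encard hsub).trans ((Set.encard_insert_le _ _).trans ?_)
  rw [Set.encard_singleton]
  exact le_of_eq one_add_one_eq_two

lemma topIndices_twoValued {x : Simplex n} {A : Finset (Fin n)} {a b : ℝ} (hA : A.Nonempty)
    (hab : b < a) (hx : ∀ i, x.1 i = if i ∈ A then a else b) : topIndices x = A := by
  obtain ⟨p, hp⟩ := hA
  ext i
  simp only [topIndices, Set.mem_ofPred_eq, Finset.mem_coe]
  constructor
  · intro h
    by_contra hi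
    have := h p
    rw [hx, hx, if_pos hp, if_neg hi] at this
    linarith
  · intro hi j
    rw [hx i, hx j, if_pos hi]
    split_ifs
    · exact le_rfl
    · exact hab.le

lemma topIndices_relIso (h : RelIso (BayesLE (n := n)) (BayesLE (n := n)))
    (hmax : ∀ e ∈ maxElements n, h e = e) (x : Simplex n) : topIndices (h x) = topIndices x := by
  ext i
  rw [← le_pure_iff, ← le_pure_iff, ← h.map_rel_iff (a := x), hmax _ (pure_mem_maxElements i)]

/-- An automorphism fixing the pure states and a map strictly monotone on the axes fixes every
two-level state. -/
lemma relIso_twoLevel {β : Type*} [Preorder β] (f : Simplex n → β)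
    (hf : ∀ x ∈ degenerateCoord n, StrictIncOn f (axis x) ∨ StrictDecOn f (axis x))
    (h : RelIso (BayesLE (n := n)) (BayesLE (n := n)))
    (hmax : ∀ e ∈ maxElements n, h e = e) (hfix : ∀ x, f (h x) = f x)
    {y : Simplex n} {A : Finset (Fin n)} {a t : ℝ} (ha : 0 < a) (ht : 0 < t)
    (ht1 : t < 1) (hy : ∀ i, y.1 i = if i ∈ A then a else t * a) (hA : A.Nonempty)
    {q : Fin n} (hq : q ∉ A) : h y = y := by
  have hta : t * a < a := by nlinarith
  have htopy : topIndices y = A := topIndices_twoValued hA hta hy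
  have htop : topIndices (h y) = A := (topIndices_relIso h hmax y).trans htopy
  have hchain : ∀ u v, BayesLE u (h y) → BayesLE v (h y) → BayesLE u v ∨ BayesLE v u := by
    intro u v hu hv
    have hu' : BayesLE (h.symm u) y := by rwa [← h.map_rel_iff, h.apply_symm_apply]
    have hv' : BayesLE (h.symm v) y := by rwa [← h.map_rel_iff, h.apply_symm_apply]
    rcases twoLevel_lower_total ha ht ht1 hy hA hq hu' hv' with H | H
    · exact Or.inl (h.symm.map_rel_iff.1 H)
    · exact Or.inr (h.symm.map_rel_iff.1 H)
  obtain ⟨p, hp⟩ := hA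
  have hpt : ∀ i ∈ A, ∀ j, (h y).1 j ≤ (h y).1 i := fun i hi => by
    have : i ∈ topIndices (h y) := by rw [htop]; exact hi
    exact this
  have hlt : ∀ j ∉ A, (h y).1 j < (h y).1 p := by
    intro j hj
    by_contra hle
    have : j ∈ topIndices (h y) := fun k => (hpt p hp k).trans (not_lt.1 hle)
    rw [htop] at this
    exact hj this
  have hshape : ∀ i, (h y).1 i = if i ∈ A then (h y).1 p else (h y).1 q := by
    intro i
    split_ifs with hi
    · exact le_antisymm (hpt p hp i) (hpt i hi p)
    · rcases lt_trichotomy ((h y).1 i) ((h y).1 q) with H | H | H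
      · exact (not_three_values_of_lower_total hchain H (hlt q hq)).elim
      · exact H
      · exact (not_three_values_of_lower_total hchain H (hlt i hi)).elim
  -- The `t = 0` state serves only to label the axis of `A`.
  obtain ⟨w, b, hb, hw⟩ := exists_twoLevel A ⟨p, hp⟩ 0 le_rfl
  have hwtop : topIndices w = A := topIndices_twoValued ⟨p, hp⟩ (by simpa using hb) hw
  have hwd : w ∈ degenerateCoord n :=
    ⟨mem_coord_of_twoValued hw, q, by rw [hw, if_neg hq, zero_mul]⟩
  have hyax : y ∈ axis w := ⟨mem_coord_of_twoValued hy, by rw [htopy, hwtop]⟩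
  have hhax : h y ∈ axis w := ⟨mem_coord_of_twoValued hshape, by rw [htop, hwtop]⟩
  by_contra hne
  rcases twoValued_total hy hshape hta.le (hlt q hq).le with H | H <;> rcases hf w hwd with F | F
  · exact (F y hyax _ hhax H (Ne.symm hne)).ne (hfix y).symm
  · exact (F y hyax _ hhax H (Ne.symm hne)).ne (hfix y)
  · exact (F _ hhax y hyax H hne).ne (hfix y)
  · exact (F _ hhax y hyax H hne).ne (hfix y).symm

lemma le_relIso_apply {β : Type*} [Preorder β] (f : Simplex n → β)
    (hf : ∀ x ∈ degenerateCoord n, StrictIncOn f (axis x) ∨ StrictDecOn f (axis x))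
    (h : RelIso (BayesLE (n := n)) (BayesLE (n := n)))
    (hmax : ∀ e ∈ maxElements n, h e = e) (hfix : ∀ x, f (h x) = f x) (x : Simplex n) :
    BayesLE x (h x) := by
  refine le_of_twoLevel_le fun A t hA ht ht1 hx i hi j hj => ?_
  obtain ⟨y, a, ha, hy⟩ := exists_twoLevel A hA t ht.le
  have hyx : BayesLE y x := (twoLevel_le_iff ha ht.le ht1 hy x).2 hx
  have hyh : BayesLE y (h x) := by
    rw [← h.map_rel_iff, relIso_twoLevel f hf h hmax hfix ha ht ht1 hy hA hj] at hyx
    exact hyx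
  exact (twoLevel_le_iff ha ht.le ht1 hy (h x)).1 hyh i hi j hj

theorem relIso_eq_refl_iff {β : Type*} [Preorder β] (f : Simplex n → β)
    (hf : ∀ x ∈ degenerateCoord n, StrictIncOn f (axis x) ∨ StrictDecOn f (axis x))
    (h : RelIso (BayesLE (n := n)) (BayesLE (n := n))) :
    ((∀ e ∈ maxElements n, h e = e) ∧ (∀ x, f (h x) = f x)) ↔ h = RelIso.refl _ := by
  constructor
  · rintro ⟨hmax, hfix⟩
    ext1 x
    have h1 := le_relIso_apply f hf h hmax hfix x
    have h2 := le_relIso_apply f hf h.symm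
      (fun e he => by rw [RelIso.symm_apply_eq, hmax e he])
      (fun z => by rw [← hfix (h.symm z), h.apply_symm_apply]) x
    rw [← h.map_rel_iff, h.apply_symm_apply] at h2
    exact h2.antisymm h1
  · rintro rfl
    exact ⟨fun _ _ => rfl, fun _ => rfl⟩

/-! ### Entropy along an axis -/

lemma eq_of_notMem_topIndices {x : Simplex n} (hx : x ∈ coord n) {i j : Fin n}
    (hi : i ∉ topIndices x) (hj : j ∉ topIndices x) : x.1 i = x.1 j := by
  obtain ⟨m, hm⟩ := exists_topIndex x
  have hne : ∀ k, k ∉ topIndices x → x.1 k ≠ x.1 m := fun k hk he => hk fun l => he ▸ hm l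
  by_contra hij
  have h3 : ({x.1 i, x.1 j, x.1 m} : Set ℝ).encard = 3 :=
    Set.encard_eq_three.2 ⟨_, _, _, hij, hne i hi, hne j hj, rfl⟩
  have hsub : ({x.1 i, x.1 j, x.1 m} : Set ℝ) ⊆ spec x := by
    rintro _ (rfl | rfl | rfl) <;> exact ⟨_, rfl⟩
  have := (Set.encard_le_encard hsub).trans hx
  rw [h3] at this
  exact absurd this (by decide)

/-- Pointwise form of the Gibbs inequality. -/
lemma gibbs_pointwise {y z : ℝ} (hy : 0 < y) (hz : 0 ≤ z) (hne : z ≠ y) :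
    z * Real.log y + (z - y) < z * Real.log z := by
  rcases hz.eq_or_lt with rfl | hz
  · simpa using hy
  · have h := Real.log_lt_sub_one_of_pos (div_pos hy hz)
      (fun h => hne ((div_eq_one_iff_eq hz.ne').1 h).symm)
    rw [Real.log_div hy.ne' hz.ne'] at h
    have h' := mul_lt_mul_of_pos_left h hz
    have e : z * (y / z - 1) = y - z := by field_simp
    rw [e] at h'
    linarith

/-- Moving up moves mass onto the top indices, so `∑ z log z > ∑ z log y ≥ ∑ y log y`: Gibbs, then
the larger `log y` on the top set. -/
lemma entropy_strictDecOn_axis (x : Simplex n) : StrictDecOn entropy (axis x) := by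
  rintro y ⟨hyc, hyt⟩ z ⟨hzc, hzt⟩ hyz hne
  obtain ⟨p, hp⟩ := exists_topIndex y
  have hp0 := topIndex_pos y hp
  have hzy : topIndices z = topIndices y := hzt.trans hyt.symm
  have hyz' := (bayesLE_iff _ _).1 hyz
  have hpz : ∀ j, z.1 j ≤ z.1 p := by
    have : p ∈ topIndices z := by rw [hzy]; exact hp
    exact this
  have hmul : ∀ i ∈ topIndices y, ∀ j, y.1 i * z.1 j ≤ y.1 j * z.1 i := by
    intro i hi j
    have hiz : i ∈ topIndices z := by rw [hzy]; exact hi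
    exact (hyz' i j).2 (hi j) (hiz j)
  have hge : ∀ i ∈ topIndices y, y.1 i ≤ z.1 i := by
    intro i hi
    have := Finset.sum_le_sum fun j (_ : j ∈ Finset.univ) => hmul i hi j
    rwa [← Finset.mul_sum, ← Finset.sum_mul, coord_sum, coord_sum, mul_one, one_mul] at this
  -- A zero of `y` makes both states vanish off the top set; `y ≤ z` entrywise with equal sums then
  -- gives `y = z`.
  have hypos : ∀ i, 0 < y.1 i := by
    intro q
    by_contra hq
    have hq0 : y.1 q = 0 := le_antisymm (not_lt.1 hq) (coord_nonneg y q)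
    have hqt : q ∉ topIndices y := fun h => by linarith [h p]
    have hoff : ∀ j ∉ topIndices y, y.1 j = 0 ∧ z.1 j = 0 := by
      intro j hj
      have hj0 : y.1 j = 0 := (eq_of_notMem_topIndices hyc hj hqt).trans hq0
      refine ⟨hj0, ?_⟩
      have := hmul p hp j
      rw [hj0, zero_mul] at this
      exact le_antisymm (nonpos_of_mul_nonpos_right this hp0) (coord_nonneg z j)
    have hle : ∀ i, y.1 i ≤ z.1 i := fun i => by
      by_cases hi : i ∈ topIndices y
      · exact hge i hi
      · rw [(hoff i hi).1, (hoff i hi).2]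
    refine hne (Subtype.ext (funext fun i => ?_))
    exact (Finset.sum_eq_sum_iff_of_le fun i _ => hle i).1
      ((coord_sum y).trans (coord_sum z).symm) i (Finset.mem_univ i)
  obtain ⟨r, hr⟩ : ∃ r, z.1 r ≠ y.1 r := by
    by_contra h
    push Not at h
    exact hne (Subtype.ext (funext fun i => (h i).symm))
  have hgibbs : ∑ i, (z.1 i * Real.log (y.1 i) + (z.1 i - y.1 i)) < ∑ i, z.1 i * Real.log (z.1 i) := by
    refine Finset.sum_lt_sum (fun i _ => ?_)
      ⟨r, Finset.mem_univ r, gibbs_pointwise (hypos r) (coord_nonneg z r) hr⟩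
    rcases eq_or_ne (z.1 i) (y.1 i) with h | h
    · rw [h]; linarith
    · exact (gibbs_pointwise (hypos i) (coord_nonneg z i) h).le
  obtain ⟨b, hb0, hb⟩ : ∃ b, (∀ i, b ≤ y.1 i) ∧ 0 < b ∧ ∀ i ∉ topIndices y, y.1 i = b := by
    obtain ⟨s, -, hs⟩ := Finset.exists_min_image Finset.univ y.1 ⟨p, Finset.mem_univ p⟩
    refine ⟨y.1 s, fun i => hs i (Finset.mem_univ i), hypos s, fun i hi => ?_⟩
    by_cases hst : s ∈ topIndices y
    · exact le_antisymm (hst i) (hs i (Finset.mem_univ i))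
    · exact eq_of_notMem_topIndices hyc hi hst
  -- The left side is zero since `z - y` has total zero; off the top set `log y` equals `log b`.
  have hcheb : ∑ i, (z.1 i - y.1 i) * Real.log b ≤ ∑ i, (z.1 i - y.1 i) * Real.log (y.1 i) := by
    refine Finset.sum_le_sum fun i _ => ?_
    by_cases hi : i ∈ topIndices y
    · exact mul_le_mul_of_nonneg_left (Real.log_le_log hb.1 (hb0 i)) (sub_nonneg.2 (hge i hi))
    · rw [hb.2 i hi]
  rw [← Finset.sum_mul, Finset.sum_sub_distrib, coord_sum, coord_sum, sub_self, zero_mul] at hcheb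
  rw [Finset.sum_add_distrib, Finset.sum_sub_distrib, coord_sum, coord_sum, sub_self,
    add_zero] at hgibbs
  simp only [sub_mul, Finset.sum_sub_distrib] at hcheb
  unfold entropy
  linarith

end BayesianOrder

theorem corollary1 (n : ℕ) (hn : 2 ≤ n) :
    -- Shannon entropy: the identity is the only isomorphism fixing the pure states and entropy
    (∀ h : RelIso (BayesianOrder.BayesLE (n := n)) (BayesianOrder.BayesLE (n := n)),
      ((∀ e ∈ BayesianOrder.maxElements n, h e = e) ∧
        (∀ x, BayesianOrder.entropy (h x) = BayesianOrder.entropy x)) ↔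
      h = RelIso.refl _) ∧
    -- the same for any map that is strictly monotone on each coordinate axis
    (∀ (β : Type*) [Preorder β] (f : BayesianOrder.Simplex n → β),
      (∀ x ∈ BayesianOrder.degenerateCoord n,
        BayesianOrder.StrictIncOn f (BayesianOrder.axis x) ∨
        BayesianOrder.StrictDecOn f (BayesianOrder.axis x)) →
      ∀ h : RelIso (BayesianOrder.BayesLE (n := n)) (BayesianOrder.BayesLE (n := n)),
        ((∀ e ∈ BayesianOrder.maxElements n, h e = e) ∧ (∀ x, f (h x) = f x)) ↔
        h = RelIso.refl _) ∧
    -- Shannon entropy is such a map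
    (∀ x ∈ BayesianOrder.degenerateCoord n,
      BayesianOrder.StrictDecOn BayesianOrder.entropy (BayesianOrder.axis x)) := by
  exact ⟨BayesianOrder.relIso_eq_refl_iff _ fun x _ =>
      Or.inr (BayesianOrder.entropy_strictDecOn_axis x),
    fun _ _ f hf => BayesianOrder.relIso_eq_refl_iff f hf,
    fun x _ => BayesianOrder.entropy_strictDecOn_axis x⟩
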